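/- All graphs are finite and simple, and $\square$ denotes the cartesian product of graphs: $(u,v)$ and $(u',v')$ are adjacent in $H\square F$ iff either $uu'\in E(H)$ and $v=v'$, or $u=u'$ and $vv'\in E(F)$. Two graphs are relatively prime if they have no common factor with more than one vertex with respect to $\square$, i.e. if $H\cong K\square A$ and $F\cong K\square B$ imply $|V(K)|\le 1$. A vertex coloring of a graph is distinguishing if the identity is the only automorphism that preserves it, and $D(H)$ is the least $d$ such that $H$ has a distinguishing coloring $V(H)\to\{1,\dots,d\}$. In the distinguishing game on $H$ with $d\ge 1$ colors, two players, Gentle and Rascal, alternately choose a not yet colored vertex and color it with one of the $d$ colors, until all vertices are colored; Gentle wins if the resulting coloring is distinguishing, and Rascal wins otherwise. Let $D_{\mathcal G}(H)$ (respectively $D_{\mathcal R}(H)$) be the least $d\ge 1$ for which Gentle has a winning strategy when Gentle (respectively Rascal) plays first, and $\infty$ if there is no such $d$. **Proposition.** Let $H$ and $F$ be two connected, relatively prime graphs. Assume that $H$ is vertex-transitive, $D(H)\ge 2$ and $D(F)\le 2$. 1. If $|V(H)|$ and $|V(F)|$ are odd, then $D_{\mathcal G}(H\square F)\le D_{\mathcal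 G}(H)$. 2. If $|V(H)|$ is odd and $|V(F)|$ is even, then $D_{\mathcal R}(H\square F)\le D_{\mathcal G}(H)$. 3. If $|V(H)|$ is even, then $D_{\mathcal R}(H\square F)\le D_{\mathcal R}(H)$. -/

import Mathlib

namespace SimpleGraph

universe u v

/-- `G` is vertex-transitive: its automorphism group acts transitively on the vertices. -/
def IsVertexTransitive {V : Type u} (G : SimpleGraph V) : Prop :=
  ∀ x y : V, ∃ σ : G ≃g G, σ x = y

/-- Two finite graphs are relatively prime (for the cartesian product) if they have no common
cartesian factor with more than one vertex. Factors of finite graphs are finite, so up to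
isomorphism they live on some `Fin n`. -/
def RelativelyPrime {V : Type u} {W : Type v} (H : SimpleGraph V) (F : SimpleGraph W) : Prop :=
  ∀ (k a b : ℕ) (K : SimpleGraph (Fin k)) (A : SimpleGraph (Fin a)) (B : SimpleGraph (Fin b)),
    Nonempty (H ≃g K □ A) → Nonempty (F ≃g K □ B) → k ≤ 1

/-- A vertex coloring is distinguishing if the identity is the only automorphism preserving it. -/
def IsDistinguishing {V : Type u} {C : Type v} (G : SimpleGraph V) (c : V → C) : Prop :=
  ∀ σ : G ≃g G, (∀ x, c (σ x) = c x) → ∀ x, σ x = x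

/-- The distinguishing number `D(G)`: the least `d` such that `G` has a distinguishing coloring
with colors from a set of size `d`. -/
noncomputable def distinguishingNumber {V : Type u} (G : SimpleGraph V) : ℕ∞ :=
  ⨅ (d : ℕ) (_ : ∃ c : V → Fin d, G.IsDistinguishing c), (d : ℕ∞)

namespace DistinguishingGame

/-- The two players. -/
inductive Player : Type
  | gentle : Player
  | rascal : Player

/-- A move: the choice of a vertex and of a color for it. -/
abbrev Move (V : Type u) (d : ℕ) : Type u := V × Fin d

/-- The vertices colored by a sequence of moves (listed from the first move to the last one). -/
def colored {V : Type u} {d : ℕ} (p : List (Move V d)) : List V := p.map Prod.fst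

/-- A strategy for Gentle: given the sequence of moves made so far, it selects a move, which must
color a not yet colored vertex as long as there is one. -/
structure Strategy (V : Type u) (d : ℕ) : Type u where
  move : List (Move V d) → Move V d
  legal : ∀ p : List (Move V d), (∃ x, x ∉ colored p) → (move p).1 ∉ colored p

/-- When the players alternate and `first` plays first, move number `i` (counted from `0`) is made
by Gentle. -/
def GentleTurn (first : Player) (i : ℕ) : Prop :=
  match first with
  | Player.gentle => Even i
  | Player.rascal => Odd i

/-- `p` is a complete play of the game started by `first`, in which Gentle follows the
strategy `s`: every vertex is colored exactly once, and every move of Gentle is the one selected by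
`s`. The moves of Rascal are arbitrary. -/
structure IsPlay {V : Type u} {d : ℕ} (first : Player) (s : Strategy V d)
    (p : List (Move V d)) : Prop where
  nodup : (colored p).Nodup
  complete : ∀ x, x ∈ colored p
  follows : ∀ (i : ℕ) (hi : i < p.length), GentleTurn first i → p[i] = s.move (p.take i)

/-- The strategy `s` is winning for Gentle on `G` if every complete play following it ends with
a distinguishing coloring. -/
def Strategy.IsWinning {V : Type u} {d : ℕ} (s : Strategy V d) (G : SimpleGraph V)
    (first : Player) : Prop :=
  ∀ p : List (Move V d), IsPlay first s p →
    ∀ c : V → Fin d, (∀ m ∈ p, c m.1 = m.2) → G.IsDistinguishing c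

/-- The least positive number of colors for which Gentle has a winning strategy on `G` when `first`
plays first; it is `⊤` if there is no such number. -/
noncomputable def gameNumber {V : Type u} (G : SimpleGraph V) (first : Player) : ℕ∞ :=
  ⨅ (d : ℕ) (_ : 0 < d ∧ ∃ s : Strategy V d, s.IsWinning G first), (d : ℕ∞)

end DistinguishingGame

/-- The `G`-game distinguishing number `D_𝒢`: Gentle plays first. -/
noncomputable def gGameNumber {V : Type u} (G : SimpleGraph V) : ℕ∞ :=
  DistinguishingGame.gameNumber G DistinguishingGame.Player.gentle

/-- The `R`-game distinguishing number `D_ℛ`: Rascal plays first. -/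
noncomputable def rGameNumber {V : Type u} (G : SimpleGraph V) : ℕ∞ :=
  DistinguishingGame.gameNumber G DistinguishingGame.Player.rascal

end SimpleGraph

/-!
Call a copy of `H` in `H □ F` a layer. As `H` and `F` are connected and relatively prime, every
automorphism of `H □ F` is a product `σ × τ` (`RelativelyPrime.exists_automorphisms`). Indeed layers
are geodesically convex and geodesically convex sets of a product are boxes, so if an automorphism
maps a layer of `H` to something else than a layer of `H`, one side of the resulting box is a
nontrivial common factor of `H` and `F`. Hence a coloring of `H □ F` is distinguishing as soon as

* one of the layers has a distinguishing coloring, and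
* for some color `a₀`, the parity of the number of vertices of color `a₀` in the layer at `v` is, up
  to a constant, a distinguishing 2-coloring `c` of `F`, which exists since `D(F) ≤ 2`.

Gentle arranges to make the last move in every layer. If `|V(H)|` is even, she answers in the layer
where Rascal has just played. If it is odd, she answers in the same layer unless Rascal has just
opened that layer, in which case she opens another one; the parity of the number of uncolored
vertices guarantees that there is one. Up to the completion of the first layer, she follows in each
layer her winning strategy on `H`; when `|V(H)|` is odd the opening move, whoever made it, counts as
hers, and it is a winning one because `H` is vertex-transitive and the colors are interchangeable
(`Wins.opening`). So the first complete layer has a distinguishing coloring. From then on she uses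
her last move in each layer to adjust its parity to that of the complete layers and `c`; no
particular parity is required of the first complete layer, as it fixes the constant.

The argument is carried out on winning positions (`Wins`) rather than strategies, which is justified
by `exists_isWinning_iff_wins`; the condition maintained by Gentle is `Invariant`.
-/

namespace SimpleGraph

/-! ### Automorphisms of a cartesian product of relatively prime graphs -/

section BoxProd

variable {V W V' W' : Type*} {H : SimpleGraph V} {F : SimpleGraph W}
  {H' : SimpleGraph V'} {F' : SimpleGraph W'}

theorem Connected.dist_boxProd (hH : H.Connected) (hF : F.Connected) (p q : V × W) :
    (H □ F).dist p q = H.dist p.1 q.1 + F.dist p.2 q.2 := by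
  rw [dist, edist_boxProd, dist, dist, ENat.toNat_add]
  · exact edist_ne_top_iff_reachable.2 (hH _ _)
  · exact edist_ne_top_iff_reachable.2 (hF _ _)

theorem Iso.edist_apply_le (φ : H ≃g F) (x y : V) : F.edist (φ x) (φ y) ≤ H.edist x y := by
  by_cases hr : H.Reachable x y
  · obtain ⟨w, hw⟩ := hr.exists_walk_length_eq_edist
    rw [← hw, ← Walk.length_map φ.toHom]
    exact edist_le _
  · exact edist_eq_top_of_not_reachable hr ▸ le_top

theorem Iso.dist_apply (φ : H ≃g F) (x y : V) : F.dist (φ x) (φ y) = H.dist x y := by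
  refine congrArg ENat.toNat (le_antisymm (Iso.edist_apply_le φ x y) ?_)
  simpa using Iso.edist_apply_le φ.symm (φ x) (φ y)

/-- The preimage of a layer of a cartesian product under an isomorphism of cartesian products is a
box: layers are geodesically convex, and a geodesically convex set `S` containing `p` and `q` also
contains `(p.1, q.2)`, which lies between them. -/
theorem Iso.snd_apply_mk_eq (hH : H.Connected) (hF : F.Connected) (hH' : H'.Connected)
    (hF' : F'.Connected) (φ : (H □ F) ≃g (H' □ F')) {p q : V × W} (h : (φ p).2 = (φ q).2) :
    (φ (p.1, q.2)).2 = (φ p).2 := by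
  have key : (H □ F).dist p (p.1, q.2) + (H □ F).dist (p.1, q.2) q = (H □ F).dist p q := by
    simp only [hH.dist_boxProd hF, dist_self]
    omega
  rw [← φ.dist_apply, ← φ.dist_apply, ← φ.dist_apply] at key
  simp only [hH'.dist_boxProd hF'] at key
  have h1 := hH'.dist_triangle (u := (φ p).1) (v := (φ (p.1, q.2)).1) (w := (φ q).1)
  rw [h, dist_self] at key
  have h2 : F'.dist (φ q).2 (φ (p.1, q.2)).2 = 0 := by omega
  rw [h, hF'.dist_eq_zero_iff.1 h2]

/-- An isomorphism `φ` maps the layer of `H` at `v` onto a box of `H' □ F'`, so `H` is the product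
of the two sides of this box. The sides are read off at any point `(p, q)` of the box. -/
def Iso.layerIso (hH : H.Connected) (hF : F.Connected) (hH' : H'.Connected)
    (hF' : F'.Connected) (φ : (H □ F) ≃g (H' □ F')) {p : V'} {q : W'} {v : W}
    (hv : (φ.symm (p, q)).2 = v) :
    H ≃g ((H'.induce {a | (φ.symm (a, q)).2 = v}) □ (F'.induce {b | (φ.symm (p, b)).2 = v})) where
  toFun x := (⟨(φ (x, v)).1, by
      have := φ.symm.snd_apply_mk_eq hH' hF' hH hF (p := φ (x, v)) (q := (p, q)) (by simp [hv])
      simpa using this⟩, ⟨(φ (x, v)).2, by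
      have := φ.symm.snd_apply_mk_eq hH' hF' hH hF (p := (p, q)) (q := φ (x, v)) (by simp [hv])
      simpa [hv] using this⟩)
  invFun ab := (φ.symm (ab.1, ab.2)).1
  left_inv x := by simp
  right_inv := by
    rintro ⟨⟨a, ha⟩, ⟨b, hb⟩⟩
    have ha' : (φ.symm (a, q)).2 = v := ha
    have hb' : (φ.symm (p, b)).2 = v := hb
    have := φ.symm.snd_apply_mk_eq hH' hF' hH hF (p := (a, q)) (q := (p, b)) (by rw [ha', hb'])
    have e : ((φ.symm (a, b)).1, v) = φ.symm (a, b) := Prod.ext rfl (by simpa [ha'] using this.symm)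
    have e' : φ ((φ.symm (a, b)).1, v) = (a, b) := by rw [e]; simp
    refine Prod.ext (Subtype.ext ?_) (Subtype.ext ?_)
    · exact congrArg Prod.fst e'
    · exact congrArg Prod.snd e'
  map_rel_iff' := by
    intro x y
    have h := φ.map_adj_iff (v := (x, v)) (w := (y, v))
    rw [boxProd_adj_left] at h
    rw [← h]
    simp [boxProd_adj, Subtype.ext_iff]

/-- The cartesian product of two graph isomorphisms. -/
def Iso.boxProdCongr (e : H ≃g H') (f : F ≃g F') : (H □ F) ≃g (H' □ F') where
  toEquiv := e.toEquiv.prodCongr f.toEquiv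
  map_rel_iff' := by
    intro x y
    simp [boxProd_adj, Iso.map_adj_iff e, Iso.map_adj_iff f]

theorem RelativelyPrime.symm (h : H.RelativelyPrime F) : F.RelativelyPrime H :=
  fun k a b K A B h1 h2 => h k b a K B A h2 h1

theorem RelativelyPrime.card_le_one (h : H.RelativelyPrime F) {X Y Z : Type*} [Fintype X]
    [Finite Y] [Finite Z] {K : SimpleGraph X} {A : SimpleGraph Y} {B : SimpleGraph Z}
    (hA : H ≃g (K □ A)) (hB : F ≃g (K □ B)) : Fintype.card X ≤ 1 := by
  have := Fintype.ofFinite Y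
  have := Fintype.ofFinite Z
  exact h _ _ _ _ _ _ ⟨hA.trans (Iso.boxProdCongr (K.overFinIso rfl) (A.overFinIso rfl))⟩
    ⟨hB.trans (Iso.boxProdCongr (K.overFinIso rfl) (B.overFinIso rfl))⟩

/-- An automorphism of the product maps layers of the first factor into layers of the first factor.
The image of a layer through `(x, v)` is a box `A × B`, the preimage of the layer of the second
factor through `φ (x, v)` is a box `C × D`, and `B` and `C` are both isomorphic to the intersection
of these layers; so `B ≅ C` is a common factor of `H ≅ A □ B` and `F ≅ C □ D`. -/
theorem RelativelyPrime.snd_apply_eq [Finite V] [Finite W] (hprime : H.RelativelyPrime F)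
    (hH : H.Connected) (hF : F.Connected) (φ : (H □ F) ≃g (H □ F)) (x y : V) (v : W) :
    (φ (x, v)).2 = (φ (y, v)).2 := by
  classical
  obtain ⟨p, q, hpq⟩ : ∃ p q, φ (x, v) = (p, q) := ⟨_, _, rfl⟩
  have hv : (φ.symm (p, q)).2 = v := by rw [← hpq]; simp
  let ψ : (F □ H) ≃g (H □ F) := (boxProdComm F H).trans φ.symm
  have hψ : ∀ z, ψ.symm z = (φ z).swap := fun z => rfl
  have hp : (ψ.symm (x, v)).2 = p := by rw [hψ, hpq]; rfl
  let e₁ := φ.layerIso hH hF hH hF hv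
  let e₂ := ψ.layerIso hF hH hH hF hp
  let e₃ : H.induce {c | (ψ.symm (c, v)).2 = p} ≃g F.induce {b | (φ.symm (p, b)).2 = v} :=
    { toFun := fun c => ⟨(φ (c, v)).2, by
        have hc : (φ (c, v)).1 = p := c.2
        have : (p, (φ (c, v)).2) = φ (c, v) := Prod.ext hc.symm rfl
        simp [this]⟩
      invFun := fun b => ⟨(φ.symm (p, b)).1, by
        have hb : (φ.symm (p, b)).2 = v := b.2
        have : ((φ.symm (p, (b : W))).1, v) = φ.symm (p, b) := Prod.ext rfl hb.symm
        simp [this, hψ]⟩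
      left_inv := by
        rintro ⟨c, hc⟩
        have hc' : (φ (c, v)).1 = p := hc
        have : (p, (φ (c, v)).2) = φ (c, v) := Prod.ext hc'.symm rfl
        simp [this]
      right_inv := by
        rintro ⟨b, hb⟩
        have hb' : (φ.symm (p, b)).2 = v := hb
        have : ((φ.symm (p, b)).1, v) = φ.symm (p, b) := Prod.ext rfl hb'.symm
        simp [this]
      map_rel_iff' := by
        rintro ⟨c, hc⟩ ⟨c', hc'⟩
        have h1 : (φ (c, v)).1 = p := hc
        have h2 : (φ (c', v)).1 = p := hc'
        have h := φ.map_adj_iff (v := (c, v)) (w := (c', v))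
        rw [boxProd_adj_left] at h
        simp only [comap_adj, Function.Embedding.subtype_apply, Equiv.coe_fn_mk]
        rw [← h]
        simp only [boxProd_adj, h1, h2, SimpleGraph.irrefl, false_and, and_true, false_or] }
  have := Fintype.ofFinite {b | (φ.symm (p, b)).2 = v}
  have hcard := hprime.card_le_one (e₁.trans (boxProdComm _ _))
    (e₂.trans (Iso.boxProdCongr e₃ (Iso.refl (G := F.induce _))))
  rw [Fintype.card_le_one_iff] at hcard
  exact congrArg Subtype.val (hcard (e₁ x).2 (e₁ y).2)

theorem RelativelyPrime.fst_apply_eq [Finite V] [Finite W] (hprime : H.RelativelyPrime F)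
    (hH : H.Connected) (hF : F.Connected) (φ : (H □ F) ≃g (H □ F)) (x : V) (v w : W) :
    (φ (x, v)).1 = (φ (x, w)).1 :=
  hprime.symm.snd_apply_eq hF hH
    ((boxProdComm F H).trans (φ.trans (boxProdComm H F))) v w x

/-- Automorphisms of the cartesian product of two connected relatively prime graphs are products of
automorphisms of the factors. -/
theorem RelativelyPrime.exists_automorphisms [Finite V] [Finite W] (hprime : H.RelativelyPrime F)
    (hH : H.Connected) (hF : F.Connected) (φ : (H □ F) ≃g (H □ F)) :
    ∃ (σ : H ≃g H) (τ : F ≃g F), ∀ x v, φ (x, v) = (σ x, τ v) := by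
  obtain ⟨x₀⟩ := hH.nonempty
  obtain ⟨v₀⟩ := hF.nonempty
  have split : ∀ (ψ : (H □ F) ≃g (H □ F)) x v, ψ (x, v) = ((ψ (x, v₀)).1, (ψ (x₀, v)).2) :=
    fun ψ x v => Prod.ext (hprime.fst_apply_eq hH hF ψ x v v₀)
      (hprime.snd_apply_eq hH hF ψ x x₀ v)
  have inv₁ : ∀ (ψ : (H □ F) ≃g (H □ F)) x, (ψ.symm ((ψ (x, v₀)).1, v₀)).1 = x := by
    intro ψ x
    rw [hprime.fst_apply_eq hH hF ψ.symm _ v₀ (ψ (x, v₀)).2]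
    simp
  have inv₂ : ∀ (ψ : (H □ F) ≃g (H □ F)) v, (ψ.symm (x₀, (ψ (x₀, v)).2)).2 = v := by
    intro ψ v
    rw [hprime.snd_apply_eq hH hF ψ.symm x₀ (ψ (x₀, v)).1]
    simp
  refine ⟨⟨⟨fun x => (φ (x, v₀)).1, fun x => (φ.symm (x, v₀)).1, inv₁ φ, inv₁ φ.symm⟩, ?_⟩,
    ⟨⟨fun v => (φ (x₀, v)).2, fun v => (φ.symm (x₀, v)).2, inv₂ φ, inv₂ φ.symm⟩, ?_⟩,
    fun x v => split φ x v⟩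
  · intro x y
    have h := φ.map_adj_iff (v := (x, v₀)) (w := (y, v₀))
    rw [boxProd_adj_left, split φ x, split φ y, boxProd_adj_left] at h
    exact h
  · intro v w
    have h := φ.map_adj_iff (v := (x₀, v)) (w := (x₀, w))
    rw [boxProd_adj_right, split φ x₀ v, split φ x₀ w, boxProd_adj_right] at h
    exact h

end BoxProd

namespace DistinguishingGame

/-! ### Winning positions -/

section Positions

variable {V : Type*} {d : ℕ}

/-- `Wins G t P`: Gentle can force a distinguishing coloring of `G` from the partial coloring `P`
(where `none` marks an uncolored vertex) when `t` is to move. -/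
inductive Wins [DecidableEq V] (G : SimpleGraph V) : Player → (V → Option (Fin d)) → Prop
  | full (t : Player) (c : V → Fin d) : G.IsDistinguishing c → Wins G t (fun x => some (c x))
  | gentle (P : V → Option (Fin d)) (x : V) (a : Fin d) : P x = none →
      Wins G Player.rascal (Function.update P x (some a)) → Wins G Player.gentle P
  | rascal (P : V → Option (Fin d)) : (∃ x, P x = none) →
      (∀ x a, P x = none → Wins G Player.gentle (Function.update P x (some a))) →
      Wins G Player.rascal P

variable [DecidableEq V] {G : SimpleGraph V}

theorem Wins.isDistinguishing {t : Player} {c : V → Fin d} (h : Wins G t fun x => some (c x)) :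
    G.IsDistinguishing c := by
  generalize hP : (fun x => some (c x)) = P at h
  cases h with
  | full t c' hc' =>
    have : c = c' := by
      funext x
      simpa using congrFun hP x
    rwa [this]
  | gentle P x a hx _ => simp [← hP] at hx
  | rascal P hx _ =>
    obtain ⟨x, hx⟩ := hx
    simp [← hP] at hx

theorem Wins.exists_move {P : V → Option (Fin d)} (h : Wins G Player.gentle P)
    (hP : ∃ x, P x = none) :
    ∃ x a, P x = none ∧ Wins G Player.rascal (Function.update P x (some a)) := by
  cases h with
  | full t c hc => simp at hP
  | gentle P x a hx hw => exact ⟨x, a, hx, hw⟩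

theorem Wins.forall_move {P : V → Option (Fin d)} (h : Wins G Player.rascal P) {x : V}
    (hx : P x = none) (a : Fin d) : Wins G Player.gentle (Function.update P x (some a)) := by
  cases h with
  | full t c hc => simp at hx
  | rascal P _ hw => exact hw x a hx

theorem Wins.exists_isDistinguishing (hd : 0 < d) {t : Player} {P : V → Option (Fin d)}
    (h : Wins G t P) : ∃ c : V → Fin d, G.IsDistinguishing c := by
  induction h with
  | full t c hc => exact ⟨c, hc⟩
  | gentle P x a hx hw ih => exact ih
  | rascal P hP hw ih =>
    obtain ⟨x, hx⟩ := hP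
    exact ih x ⟨0, hd⟩ hx

/-- Automorphisms of the graph and permutations of the colors are symmetries of the game. -/
theorem Wins.map_comp {t : Player} {P : V → Option (Fin d)} (h : Wins G t P) (σ : G ≃g G)
    (π : Equiv.Perm (Fin d)) : Wins G t fun x => (P (σ x)).map π := by
  have update_comp : ∀ (P : V → Option (Fin d)) (x : V) (a : Fin d),
      (fun z => (Function.update P (σ x) (some a) (σ z)).map π) =
        Function.update (fun z => (P (σ z)).map π) x (some (π a)) := by
    intro P x a
    funext z
    by_cases hz : z = x
    · subst hz
      simp
    · rw [Function.update_of_ne hz, Function.update_of_ne (by simpa using hz)]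
  induction h with
  | full t c hc =>
    refine Wins.full t (fun x => π (c (σ x))) fun ρ hρ x => ?_
    have := hc ((σ.symm.trans ρ).trans σ) (fun y => by simpa using hρ (σ.symm y)) (σ x)
    simpa using this
  | gentle P x a hx hw ih =>
    refine Wins.gentle _ (σ.symm x) (π a) (by simp [hx]) ?_
    rw [← update_comp]
    simpa using ih
  | rascal P hP hw ih =>
    obtain ⟨x, hx⟩ := hP
    refine Wins.rascal _ ⟨σ.symm x, by simp [hx]⟩ fun y a hy => ?_
    have := ih (σ y) (π.symm a) (by simpa using hy)
    rw [update_comp] at this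
    simpa using this

/-- If Gentle wins as first player on a vertex-transitive graph, then every opening move wins,
because the symmetries of the game carry a winning opening move to any other move. -/
theorem Wins.opening (htrans : G.IsVertexTransitive)
    (h : Wins G Player.gentle fun _ => (none : Option (Fin d))) (x : V) (a : Fin d) :
    Wins G Player.rascal (Function.update (fun _ => none) x (some a)) := by
  obtain ⟨y, b, -, hw⟩ := h.exists_move ⟨x, rfl⟩
  obtain ⟨σ, hσ⟩ := htrans x y
  convert hw.map_comp σ (Equiv.swap b a) using 1
  funext z
  by_cases hz : z = x
  · subst hz
    simp [hσ]
  · rw [Function.update_of_ne hz, Function.update_of_ne]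
    · rfl
    · rw [← hσ]
      simpa using hz

end Positions

/-! ### Strategies and winning positions -/

section Strategies

variable {V : Type*} {d : ℕ} {G : SimpleGraph V}

/-- The partial coloring reached after a sequence of moves. -/
def position [DecidableEq V] (p : List (Move V d)) : V → Option (Fin d) :=
  p.foldl (fun P m => Function.update P m.1 (some m.2)) fun _ => none

/-- The player who makes move number `i` when `first` plays first. -/
noncomputable def playerAt (first : Player) (i : ℕ) : Player :=
  open Classical in if GentleTurn first i then Player.gentle else Player.rascal

theorem gentleTurn_succ (first : Player) (i : ℕ) :
    GentleTurn first (i + 1) ↔ ¬ GentleTurn first i := by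
  cases first <;> simp [GentleTurn, parity_simps]

theorem playerAt_zero (first : Player) : playerAt first 0 = first := by
  cases first <;> simp [playerAt, GentleTurn]

theorem playerAt_of_gentleTurn {first : Player} {i : ℕ} (h : GentleTurn first i) :
    playerAt first i = Player.gentle ∧ playerAt first (i + 1) = Player.rascal := by
  simp [playerAt, gentleTurn_succ, h]

theorem playerAt_of_not_gentleTurn {first : Player} {i : ℕ} (h : ¬ GentleTurn first i) :
    playerAt first i = Player.rascal ∧ playerAt first (i + 1) = Player.gentle := by
  simp [playerAt, gentleTurn_succ, h]

variable [DecidableEq V]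

theorem position_concat (p : List (Move V d)) (m : Move V d) :
    position (p ++ [m]) = Function.update (position p) m.1 (some m.2) := by
  simp [position]

theorem position_eq_none_iff (p : List (Move V d)) (x : V) :
    position p x = none ↔ x ∉ colored p := by
  induction p using List.reverseRecOn with
  | nil => simp [position, colored]
  | append_singleton p m ih =>
    rw [position_concat]
    by_cases hx : x = m.1
    · subst hx
      simp [colored]
    · rw [Function.update_of_ne hx, ih]
      simp only [colored, List.map_append, List.mem_append, not_or]
      simp [hx]

theorem position_eq_some {p : List (Move V d)} (hp : (colored p).Nodup) {m : Move V d}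
    (hm : m ∈ p) : position p m.1 = some m.2 := by
  induction p using List.reverseRecOn with
  | nil => simp at hm
  | append_singleton p m' ih =>
    have hp' : (colored p ++ [m'.1]).Nodup := by simpa [colored] using hp
    rw [List.nodup_append] at hp'
    rw [position_concat]
    rcases List.mem_append.1 hm with h | h
    · have hne : m.1 ≠ m'.1 := hp'.2.2 _ (List.mem_map_of_mem h) _ (by simp)
      rw [Function.update_of_ne hne, ih hp'.1 h]
    · rw [List.mem_singleton.1 h, Function.update_self]

theorem Strategy.IsWinning.wins_position [Fintype V] {first : Player} {s : Strategy V d}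
    (hs : s.IsWinning G first) (n : ℕ) : ∀ p : List (Move V d), Fintype.card V - p.length = n →
      (colored p).Nodup →
      (∀ (i : ℕ) (hi : i < p.length), GentleTurn first i → p[i] = s.move (p.take i)) →
      Wins G (playerAt first p.length) (position p) := by
  induction n using Nat.strong_induction_on with
  | _ n ih =>
  intro p hn hp hfol
  by_cases hfull : ∀ x, x ∈ colored p
  · have hsome : ∀ x, ∃ a, position p x = some a := fun x =>
      Option.ne_none_iff_exists'.1 fun h => (position_eq_none_iff p x).1 h (hfull x)
    choose c hc using hsome
    rw [funext hc]
    refine Wins.full _ c (hs p ⟨hp, hfull, hfol⟩ c fun m hm => ?_)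
    have := position_eq_some hp hm
    rw [hc] at this
    simpa using this
  · push Not at hfull
    have step : ∀ m : Move V d, m.1 ∉ colored p →
        (GentleTurn first p.length → m = s.move p) →
        Wins G (playerAt first (p.length + 1)) (Function.update (position p) m.1 (some m.2)) := by
      intro m hm hmove
      have hp' : (colored (p ++ [m])).Nodup := by
        have : (colored p ++ [m.1]).Nodup := by
          rw [List.nodup_append]
          exact ⟨hp, by simp, by
            intro a ha b hb
            rw [List.mem_singleton.1 hb]
            rintro rfl
            exact hm ha⟩
        simpa [colored] using this
      have hlen : p.length + 1 ≤ Fintype.card V := by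
        simpa [colored] using hp'.length_le_card
      have := ih (Fintype.card V - (p ++ [m]).length) (by simp; omega) (p ++ [m]) rfl hp' ?_
      · rw [position_concat] at this
        simpa using this
      · intro i hi hg
        have hi' : i < p.length + 1 := by simpa using hi
        rcases Nat.lt_succ_iff_lt_or_eq.1 hi' with hlt | rfl
        · rw [List.getElem_append_left hlt, List.take_append_of_le_length hlt.le]
          exact hfol i hlt hg
        · simpa using hmove hg
    by_cases hg : GentleTurn first p.length
    · rw [(playerAt_of_gentleTurn hg).1]
      have hm := s.legal p hfull
      have := step (s.move p) hm fun _ => rfl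
      rw [(playerAt_of_gentleTurn hg).2] at this
      exact Wins.gentle _ _ _ ((position_eq_none_iff p _).2 hm) this
    · rw [(playerAt_of_not_gentleTurn hg).1]
      obtain ⟨x, hx⟩ := hfull
      refine Wins.rascal _ ⟨x, (position_eq_none_iff p x).2 hx⟩ fun y a hy => ?_
      have := step (y, a) ((position_eq_none_iff p y).1 hy) fun h => absurd h hg
      rwa [(playerAt_of_not_gentleTurn hg).2] at this

/-- From a winning position, Gentle wins by always moving to a winning position. -/
theorem Wins.exists_isWinning [Nonempty V] (hd : 0 < d) {first : Player}
    (h : Wins G first fun _ => (none : Option (Fin d))) :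
    ∃ s : Strategy V d, s.IsWinning G first := by
  classical
  let good : List (Move V d) → Move V d → Prop := fun p m =>
    position p m.1 = none ∧ Wins G Player.rascal (Function.update (position p) m.1 (some m.2))
  have hmove : ∀ p : List (Move V d), ∃ m : Move V d, ((∃ x, x ∉ colored p) → m.1 ∉ colored p) ∧
      ((∃ m', good p m') → good p m) := by
    intro p
    by_cases hg : ∃ m', good p m'
    · obtain ⟨m, hm⟩ := hg
      exact ⟨m, fun _ => (position_eq_none_iff p _).1 hm.1, fun _ => hm⟩
    · by_cases hx : ∃ x, x ∉ colored p
      · obtain ⟨x, hx⟩ := hx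
        exact ⟨(x, ⟨0, hd⟩), fun _ => hx, fun h => absurd h hg⟩
      · exact ⟨(Classical.arbitrary V, ⟨0, hd⟩), fun h => absurd h hx, fun h => absurd h hg⟩
  choose f hlegal hgood using hmove
  refine ⟨⟨f, hlegal⟩, fun p hp c hc => ?_⟩
  have key : ∀ i ≤ p.length, Wins G (playerAt first i) (position (p.take i)) := by
    intro i
    induction i with
    | zero =>
      intro _
      simpa [playerAt_zero, position] using h
    | succ i ih =>
      intro hi
      have hw := ih (by omega)
      have hlt : i < p.length := hi
      have htake : p.take (i + 1) = p.take i ++ [p[i]] := by simp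
      have hnone : position (p.take i) p[i].1 = none := by
        rw [position_eq_none_iff]
        have hnd : (colored (p.take (i + 1))).Nodup := by
          have := hp.nodup.sublist ((List.take_sublist (i + 1) p).map Prod.fst)
          exact this
        rw [htake] at hnd
        have hnd' : (colored (p.take i) ++ [p[i].1]).Nodup := by
          simpa only [colored, List.map_append, List.map_cons, List.map_nil] using hnd
        rw [List.nodup_append] at hnd'
        intro hmem
        exact hnd'.2.2 _ hmem _ (List.mem_singleton_self _) rfl
      rw [htake, position_concat]
      by_cases hg : GentleTurn first i
      · rw [(playerAt_of_gentleTurn hg).1] at hw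
        rw [(playerAt_of_gentleTurn hg).2]
        obtain ⟨x, a, hx, hxa⟩ := hw.exists_move ⟨_, hnone⟩
        have := hgood (p.take i) ⟨(x, a), hx, hxa⟩
        rw [hp.follows i hlt hg]
        exact this.2
      · rw [(playerAt_of_not_gentleTurn hg).1] at hw
        rw [(playerAt_of_not_gentleTurn hg).2]
        exact hw.forall_move hnone _
  have hfin := key p.length le_rfl
  rw [List.take_length] at hfin
  have hpos : position p = fun x => some (c x) := by
    funext x
    obtain ⟨m, hm, rfl⟩ := List.mem_map.1 (hp.complete x)
    rw [position_eq_some hp.nodup hm, hc m hm]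
  rw [hpos] at hfin
  exact hfin.isDistinguishing

theorem exists_isWinning_iff_wins [Fintype V] [Nonempty V] (hd : 0 < d) (first : Player) :
    (∃ s : Strategy V d, s.IsWinning G first) ↔ Wins G first fun _ => (none : Option (Fin d)) := by
  refine ⟨fun ⟨s, hs⟩ => ?_, fun h => h.exists_isWinning hd⟩
  have := hs.wins_position _ [] rfl (by simp [colored]) (by simp)
  simpa [playerAt_zero, position] using this

theorem gameNumber_le_gameNumber {W : Type*} [Fintype V] [Nonempty V] [Fintype W] [Nonempty W]
    [DecidableEq W] {G' : SimpleGraph W} {first first' : Player}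
    (h : ∀ d, 0 < d → Wins G first (fun _ => (none : Option (Fin d))) →
      Wins G' first' (fun _ => (none : Option (Fin d)))) :
    gameNumber G' first' ≤ gameNumber G first := by
  refine le_iInf₂ fun d hd => iInf₂_le d ⟨hd.1, ?_⟩
  rw [exists_isWinning_iff_wins hd.1]
  exact h d hd.1 ((exists_isWinning_iff_wins hd.1 first).1 hd.2)

end Strategies

/-! ### Counting uncolored vertices and vertices of a given color -/

section Counting

variable {V C : Type*} [Fintype V]

/-- The number of uncolored vertices of a partial coloring. -/
def uncolored (p : V → Option C) : ℕ := ∑ x, if (p x).isNone then 1 else 0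

/-- The parity of the number of vertices of color `a`. -/
def colorParity [DecidableEq C] (a : C) (p : V → Option C) : ZMod 2 :=
  ∑ x, if p x = some a then 1 else 0

theorem uncolored_eq_zero_iff {p : V → Option C} : uncolored p = 0 ↔ ∀ x, p x ≠ none := by
  simp [uncolored]

theorem uncolored_ne_zero_iff {p : V → Option C} : uncolored p ≠ 0 ↔ ∃ x, p x = none := by
  rw [Ne, uncolored_eq_zero_iff]
  push Not
  rfl

theorem uncolored_none : uncolored (fun _ : V => (none : Option C)) = Fintype.card V := by
  simp [uncolored]

variable [DecidableEq V]

theorem uncolored_update {p : V → Option C} {x : V} (hx : p x = none) (a : C) :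
    uncolored (Function.update p x (some a)) + 1 = uncolored p := by
  unfold uncolored
  rw [← Finset.add_sum_erase _ _ (Finset.mem_univ x),
    ← Finset.add_sum_erase (a := x) Finset.univ (fun x => if (p x).isNone then 1 else 0)
      (Finset.mem_univ x)]
  have : ∑ y ∈ Finset.univ.erase x, (if (Function.update p x (some a) y).isNone then 1 else 0) =
      ∑ y ∈ Finset.univ.erase x, if (p y).isNone then 1 else 0 := by
    refine Finset.sum_congr rfl fun y hy => ?_
    rw [Function.update_of_ne (Finset.ne_of_mem_erase hy)]
  rw [this]
  simp [hx, add_comm]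

theorem uncolored_update_none (x : V) (a : C) :
    uncolored (Function.update (fun _ => none) x (some a)) + 1 = Fintype.card V := by
  rw [uncolored_update rfl, uncolored_none]

variable [DecidableEq C]

theorem colorParity_update {p : V → Option C} {x : V} (hx : p x = none) (a b : C) :
    colorParity a (Function.update p x (some b)) = colorParity a p + if b = a then 1 else 0 := by
  unfold colorParity
  rw [← Finset.add_sum_erase _ _ (Finset.mem_univ x),
    ← Finset.add_sum_erase (a := x) Finset.univ (fun x => if p x = some a then (1 : ZMod 2) else 0)
      (Finset.mem_univ x)]
  have : ∑ y ∈ Finset.univ.erase x,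
        (if Function.update p x (some b) y = some a then (1 : ZMod 2) else 0) =
      ∑ y ∈ Finset.univ.erase x, if p y = some a then (1 : ZMod 2) else 0 := by
    refine Finset.sum_congr rfl fun y hy => ?_
    rw [Function.update_of_ne (Finset.ne_of_mem_erase hy)]
  rw [this]
  simp [hx, add_comm]

/-- With at least two colors, whoever colors a vertex decides the parity of a color class. -/
theorem exists_colorParity_update_eq [Nontrivial C] {p : V → Option C} {x : V} (hx : p x = none)
    (a : C) (t : ZMod 2) : ∃ b, colorParity a (Function.update p x (some b)) = t := by
  by_cases h : colorParity a p = t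
  · obtain ⟨b, hb⟩ := exists_ne a
    exact ⟨b, by rw [colorParity_update hx, if_neg hb, add_zero, h]⟩
  · refine ⟨a, ?_⟩
    rw [colorParity_update hx, if_pos rfl]
    generalize colorParity a p = s at h
    revert h
    revert s t
    decide

end Counting

/-! ### Playing on the layers of a cartesian product -/

section Layers

variable {V W C : Type*}

/-- The partial coloring of the first factor induced on the layer at `v`. -/
def layer (P : V × W → Option C) (v : W) : V → Option C := fun x => P (x, v)

theorem layer_none (v : W) :
    layer (fun _ : V × W => (none : Option C)) v = fun _ => none := rfl

theorem layer_update_self [DecidableEq V] [DecidableEq W] (P : V × W → Option C) (x : V) (v : W)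
    (o : Option C) :
    layer (Function.update P (x, v) o) v = Function.update (layer P v) x o := by
  funext y
  simp [layer, Function.update_apply]

theorem layer_update_of_ne [DecidableEq V] [DecidableEq W] (P : V × W → Option C) (x : V) {v w : W}
    (h : w ≠ v) (o : Option C) : layer (Function.update P (x, v) o) w = layer P w := by
  funext y
  simp [layer, h]

theorem uncolored_eq_sum_layer [Fintype V] [Fintype W] (P : V × W → Option C) :
    uncolored P = ∑ v, uncolored (layer P v) := by
  unfold uncolored layer
  rw [Fintype.sum_prod_type_right]

variable [Fintype V] [DecidableEq V]
  {d : ℕ} {H : SimpleGraph V} {F : SimpleGraph W} {c : W → ZMod 2} {a₀ : Fin d}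

/-- The condition which Gentle maintains on `H □ F` after each of her moves, where `c` is a coloring
of `F` and `a₀` a color. It is used together with the evenness of the total number of uncolored
vertices, which holds at those times because Gentle makes the last move.

* An opened layer has an even number of vertices left, so that Gentle will complete it; as long as
  no layer is complete, it is a winning position of the game on `H`. Only layers of odd order can be
  unopened, as empty layers of even order count as opened.
* As soon as some layer is complete, one of the complete layers has a distinguishing coloring.
* On the complete layers, the parity of the number of vertices of color `a₀` agrees with `c` up to
  a constant. -/
structure Invariant (H : SimpleGraph V) (c : W → ZMod 2) (a₀ : Fin d)
    (P : V × W → Option (Fin d)) : Prop where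
  opened : ∀ v, (Even (uncolored (layer P v)) ∧
      ((∀ w, uncolored (layer P w) ≠ 0) → Wins H Player.rascal (layer P v))) ∨
    (Odd (Fintype.card V) ∧ layer P v = fun _ => none)
  complete : ∀ w, uncolored (layer P w) = 0 →
    ∃ v, uncolored (layer P v) = 0 ∧ Wins H Player.rascal (layer P v)
  parity : ∀ v w, uncolored (layer P v) = 0 → uncolored (layer P w) = 0 →
    colorParity a₀ (layer P v) + c v = colorParity a₀ (layer P w) + c w

/-- A complete coloring satisfying the invariant is distinguishing. The parities of the color class
of `a₀` in the layers force the automorphism of `F` to be trivial, and then the layer with a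
distinguishing coloring is mapped to itself. -/
theorem Invariant.isDistinguishing [Finite W] (hH : H.Connected) (hF : F.Connected)
    (hprime : H.RelativelyPrime F) (hc : F.IsDistinguishing c) {P : V × W → Fin d}
    (hP : Invariant H c a₀ fun z => some (P z)) : (H □ F).IsDistinguishing P := by
  intro φ hφ
  obtain ⟨σ, τ, hστ⟩ := hprime.exists_automorphisms hH hF φ
  have hcol : ∀ x v, P (σ x, τ v) = P (x, v) := fun x v => by rw [← hστ, hφ]
  have hfull : ∀ v, uncolored (layer (fun z => some (P z)) v) = 0 := fun v =>
    uncolored_eq_zero_iff.2 fun x => by simp [layer]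
  have hτ : ∀ v, τ v = v := by
    refine hc τ fun v => ?_
    have hpar : colorParity a₀ (layer (fun z => some (P z)) (τ v)) =
        colorParity a₀ (layer (fun z => some (P z)) v) := by
      unfold colorParity
      rw [← Equiv.sum_comp σ.toEquiv]
      refine Finset.sum_congr rfl fun x _ => ?_
      have : layer (fun z => some (P z)) (τ v) (σ.toEquiv x) =
          layer (fun z => some (P z)) v x := congrArg some (hcol x v)
      rw [this]
    have := hP.parity (τ v) v (hfull _) (hfull _)
    rw [hpar] at this
    exact add_left_cancel this
  obtain ⟨w⟩ := hF.nonempty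
  obtain ⟨v, -, hv⟩ := hP.complete w (hfull w)
  have hσ := Wins.isDistinguishing (c := fun x => P (x, v)) hv σ fun x => by
    have := hcol x v
    rwa [hτ] at this
  rintro ⟨x, w⟩
  rw [hστ, hσ, hτ]

/-- Gentle opens the unopened layers at `v` and `w`; the case `v = w` is a single opening. -/
theorem Invariant.of_openings (hcard : 2 ≤ Fintype.card V) (hodd : Odd (Fintype.card V))
    (hopen : ∀ x (a : Fin d), Wins H Player.rascal (Function.update (fun _ => none) x (some a)))
    {P R : V × W → Option (Fin d)} (hP : Invariant H c a₀ P) {x : V} {a : Fin d} {v w : W}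
    (hv : layer P v = fun _ => none) (hw : layer P w = fun _ => none)
    (hRv : layer R v = Function.update (fun _ => none) x (some a))
    (hRw : layer R w = Function.update (fun _ => none) x (some a))
    (hR : ∀ u, u ≠ v → u ≠ w → layer R u = layer P u) :
    Invariant H c a₀ R := by
  have hone := uncolored_update_none (V := V) x a
  have hev : Even (uncolored (Function.update (fun _ : V => none) x (some a))) := by
    obtain ⟨k, hk⟩ := hodd
    exact ⟨k, by omega⟩
  have hnone : uncolored (fun _ : V => (none : Option (Fin d))) ≠ 0 := by
    rw [uncolored_none]
    omega
  have hcases : ∀ u, layer R u = Function.update (fun _ => none) x (some a) ∨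
      (layer R u = layer P u ∧ u ≠ v ∧ u ≠ w) := by
    intro u
    by_cases huv : u = v
    · exact Or.inl (huv ▸ hRv)
    · by_cases huw : u = w
      · exact Or.inl (huw ▸ hRw)
      · exact Or.inr ⟨hR u huv huw, huv, huw⟩
  -- The opened layers are not complete yet, since an odd order `≥ 2` is at least `3`.
  have hcompl_eq : ∀ u, uncolored (layer R u) = 0 → layer R u = layer P u := by
    intro u hu
    rcases hcases u with h | h
    · rw [h] at hu
      obtain ⟨k, hk⟩ := hodd
      omega
    · exact h.1
  have hP_complete : ∀ u, uncolored (layer P u) = 0 → layer R u = layer P u := by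
    intro u hu
    refine hR u ?_ ?_
    · rintro rfl
      exact hnone (hv ▸ hu)
    · rintro rfl
      exact hnone (hw ▸ hu)
  refine ⟨fun u => ?_, fun u hu => ?_, fun u u' hu hu' => ?_⟩
  · rcases hcases u with h | h
    · rw [h]
      exact Or.inl ⟨hev, fun _ => hopen x a⟩
    · rw [h.1]
      refine (hP.opened u).imp_left fun h' => ⟨h'.1, fun hno => h'.2 fun u' hu' => hno u' ?_⟩
      rw [hP_complete u' hu', hu']
  · obtain ⟨u', hu', hwin⟩ := hP.complete u (hcompl_eq u hu ▸ hu)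
    exact ⟨u', by rw [hP_complete u' hu', hu'], by rwa [hP_complete u' hu']⟩
  · have h := hcompl_eq u hu
    have h' := hcompl_eq u' hu'
    rw [h] at hu ⊢
    rw [h'] at hu' ⊢
    exact hP.parity u u' hu hu'

/-- Gentle's answer when Rascal opens a layer: she opens another one, which exists because the
number of uncolored vertices was even. -/
theorem Invariant.exists_reply_of_layer_eq_none [Fintype W] [DecidableEq W]
    (hcard : 2 ≤ Fintype.card V) (hodd : Odd (Fintype.card V))
    (hopen : ∀ x (a : Fin d), Wins H Player.rascal (Function.update (fun _ => none) x (some a)))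
    {P : V × W → Option (Fin d)} (hP : Invariant H c a₀ P) (htotal : Even (uncolored P)) {v : W}
    (hv : layer P v = fun _ => none) (x : V) (a : Fin d) :
    ∃ z b, Function.update P (x, v) (some a) z = none ∧
      Invariant H c a₀ (Function.update (Function.update P (x, v) (some a)) z (some b)) := by
  have hPx : P (x, v) = none := congrFun hv x
  set Q := Function.update P (x, v) (some a) with hQ
  have hQv : layer Q v = Function.update (fun _ => none) x (some a) := by
    rw [hQ, layer_update_self, hv]
  have hQP : uncolored Q + 1 = uncolored P := uncolored_update hPx a
  have hone := uncolored_update_none (V := V) x a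
  obtain ⟨w, hw⟩ : ∃ w, ¬ Even (uncolored (layer Q w)) := by
    by_contra! hall
    have h1 : Even (uncolored Q) := by
      rw [uncolored_eq_sum_layer]
      exact Finset.even_sum _ fun w _ => hall w
    rw [← hQP] at htotal
    exact Nat.not_even_iff_odd.2 h1.add_one htotal
  have hwv : w ≠ v := by
    rintro rfl
    refine hw ?_
    obtain ⟨k, hk⟩ := hodd
    exact ⟨k, by rw [hQv]; omega⟩
  have hQw : layer Q w = layer P w := layer_update_of_ne P x hwv _
  have hwnone : layer P w = fun _ => none := by
    rcases hP.opened w with h | h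
    · exact absurd (hQw ▸ h.1) hw
    · exact h.2
  have hQxw : Q (x, w) = none := by
    have := congrFun (hQw.trans hwnone) x
    exact this
  refine ⟨(x, w), a, hQxw, hP.of_openings (x := x) (a := a) hcard hodd hopen hv hwnone ?_ ?_ ?_⟩
  · rw [layer_update_of_ne _ _ hwv.symm, hQv]
  · rw [layer_update_self, hQw, hwnone]
  · intro u huv huw
    rw [layer_update_of_ne _ _ huw, hQ, layer_update_of_ne _ _ huv]

/-- Gentle's answer when Rascal plays in a layer with an even number of vertices left: she plays in
the same layer. -/
theorem Invariant.exists_reply_of_even [DecidableEq W]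
    [Nontrivial (Fin d)] {P : V × W → Option (Fin d)}
    (hP : Invariant H c a₀ P) {v : W} (hev : Even (uncolored (layer P v)))
    (hwin : (∀ w, uncolored (layer P w) ≠ 0) → Wins H Player.rascal (layer P v))
    {x : V} (hPx : P (x, v) = none) (a : Fin d) :
    ∃ z b, Function.update P (x, v) (some a) z = none ∧
      Invariant H c a₀ (Function.update (Function.update P (x, v) (some a)) z (some b)) := by
  set Q := Function.update P (x, v) (some a) with hQ
  have hPx' : layer P v x = none := hPx
  have hQv : layer Q v = Function.update (layer P v) x (some a) := layer_update_self P x v _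
  have hQPv : uncolored (layer Q v) + 1 = uncolored (layer P v) := by
    rw [hQv]
    exact uncolored_update hPx' a
  have hvne : uncolored (layer P v) ≠ 0 := by omega
  -- As long as no layer is complete, Gentle follows a winning strategy on the layer; afterwards
  -- she chooses her color so as to bring the parity in line with the complete layers.
  obtain ⟨y, b, hy, hno, hsome⟩ : ∃ y b, layer Q v y = none ∧
      ((∀ w, w ≠ v → uncolored (layer P w) ≠ 0) →
        Wins H Player.rascal (Function.update (layer Q v) y (some b))) ∧
      (∀ w, w ≠ v → uncolored (layer P w) = 0 →
        colorParity a₀ (Function.update (layer Q v) y (some b)) + c v =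
          colorParity a₀ (layer P w) + c w) := by
    have hQne : ∃ y, layer Q v y = none := by
      rw [← uncolored_ne_zero_iff]
      obtain ⟨k, hk⟩ := hev
      omega
    by_cases hall : ∀ w, w ≠ v → uncolored (layer P w) ≠ 0
    · have hw := (hwin fun w => by
        by_cases h : w = v
        · rwa [h]
        · exact hall w h).forall_move hPx' a
      rw [← hQv] at hw
      obtain ⟨y, b, hy, hyb⟩ := hw.exists_move hQne
      exact ⟨y, b, hy, fun _ => hyb, fun w hwv h0 => absurd h0 (hall w hwv)⟩
    · have hall' := hall
      push Not at hall'
      obtain ⟨w₀, -, hw₀⟩ := hall'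
      obtain ⟨y, hy⟩ := hQne
      obtain ⟨b, hb⟩ := exists_colorParity_update_eq hy a₀
        (colorParity a₀ (layer P w₀) + c w₀ - c v)
      refine ⟨y, b, hy, fun h => absurd h hall, fun w _ h0 => ?_⟩
      rw [hb, sub_add_cancel]
      exact hP.parity w₀ w hw₀ h0
  have hQyv : Q (y, v) = none := hy
  refine ⟨(y, v), b, hQyv, ?_⟩
  set R := Function.update Q (y, v) (some b) with hR
  have hRv : layer R v = Function.update (layer Q v) y (some b) := layer_update_self Q y v _
  have hRw : ∀ w, w ≠ v → layer R w = layer P w := fun w hw => by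
    rw [hR, layer_update_of_ne _ _ hw, hQ, layer_update_of_ne _ _ hw]
  have hRQv : uncolored (layer R v) + 1 = uncolored (layer Q v) := by
    rw [hRv]
    exact uncolored_update hy b
  refine ⟨fun w => ?_, fun w hw => ?_, fun u w hu hw => ?_⟩
  · by_cases hwv : w = v
    · subst hwv
      refine Or.inl ⟨?_, fun hne => ?_⟩
      · obtain ⟨k, hk⟩ := hev
        exact ⟨k - 1, by omega⟩
      · rw [hRv]
        exact hno fun u hu => hRw u hu ▸ hne u
    · rw [hRw w hwv]
      refine (hP.opened w).imp_left fun h => ⟨h.1, fun hne => h.2 fun u => ?_⟩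
      by_cases hu : u = v
      · rwa [hu]
      · exact hRw u hu ▸ hne u
  · by_cases hall : ∀ w, w ≠ v → uncolored (layer P w) ≠ 0
    · have hwv : w = v := by
        by_contra hwv
        exact hall w hwv (hRw w hwv ▸ hw)
      subst hwv
      exact ⟨w, hw, hRv ▸ hno hall⟩
    · push Not at hall
      obtain ⟨w₀, -, hw₀⟩ := hall
      obtain ⟨u, hu, hwu⟩ := hP.complete w₀ hw₀
      have huv : u ≠ v := by
        rintro rfl
        exact hvne hu
      exact ⟨u, by rwa [hRw u huv], by rwa [hRw u huv]⟩
  · by_cases huv : u = v <;> by_cases hwv : w = v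
    · rw [huv, hwv]
    · rw [hRw w hwv] at hw ⊢
      rw [huv, hRv]
      exact hsome w hwv hw
    · rw [hRw u huv] at hu ⊢
      rw [hwv, hRv]
      exact (hsome u huv hu).symm
    · rw [hRw u huv] at hu ⊢
      rw [hRw w hwv] at hw ⊢
      exact hP.parity u w hu hw

/-- Gentle wins on `H □ F` from every position satisfying the invariant with Rascal to move. -/
theorem Invariant.wins [Fintype W] [DecidableEq W] [Nontrivial (Fin d)] (hH : H.Connected)
    (hF : F.Connected)
    (hprime : H.RelativelyPrime F) (hc : F.IsDistinguishing c) (hcard : 2 ≤ Fintype.card V)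
    (hopen : Odd (Fintype.card V) →
      ∀ x (a : Fin d), Wins H Player.rascal (Function.update (fun _ => none) x (some a)))
    {P : V × W → Option (Fin d)} (hP : Invariant H c a₀ P) (heven : Even (uncolored P)) :
    Wins (H □ F) Player.rascal P := by
  induction hn : uncolored P using Nat.strong_induction_on generalizing P with
  | _ n ih =>
  by_cases hfull : uncolored P = 0
  · have hsome : ∀ z, ∃ a, P z = some a := fun z =>
      Option.ne_none_iff_exists'.1 (uncolored_eq_zero_iff.1 hfull z)
    choose P' hP' using hsome
    obtain rfl : P = fun z => some (P' z) := funext hP'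
    exact Wins.full _ _ (hP.isDistinguishing hH hF hprime hc)
  · refine Wins.rascal _ (uncolored_ne_zero_iff.1 hfull) ?_
    rintro ⟨x, v⟩ a hx
    obtain ⟨z, b, hz, hinv⟩ : ∃ z b, Function.update P (x, v) (some a) z = none ∧
        Invariant H c a₀ (Function.update (Function.update P (x, v) (some a)) z (some b)) := by
      rcases hP.opened v with h | h
      · exact hP.exists_reply_of_even h.1 h.2 hx a
      · exact hP.exists_reply_of_layer_eq_none hcard h.1 (hopen h.1) heven h.2 x a
    have h1 := uncolored_update hx a
    have h2 := uncolored_update hz b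
    refine Wins.gentle _ z b hz (ih _ (by omega) hinv ?_ rfl)
    obtain ⟨k, hk⟩ := heven
    exact ⟨k - 1, by omega⟩

theorem Invariant.initial (hcard : 2 ≤ Fintype.card V)
    (hwin : Even (Fintype.card V) → Wins H Player.rascal fun _ => (none : Option (Fin d))) :
    Invariant H c a₀ fun _ : V × W => none := by
  have hne : uncolored (fun _ : V => (none : Option (Fin d))) ≠ 0 := by
    rw [uncolored_none]
    omega
  refine ⟨fun v => ?_, fun w hw => absurd hw hne, fun v w hv _ => absurd hv hne⟩
  rw [layer_none]
  rcases Nat.even_or_odd (Fintype.card V) with h | h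
  · exact Or.inl ⟨by rwa [uncolored_none], fun _ => hwin h⟩
  · exact Or.inr ⟨h, rfl⟩

/-- If the order of `H □ F` is even, Rascal's first move leaves Gentle the last one. -/
theorem wins_boxProd_rascal [Fintype W] [DecidableEq W] [Nontrivial (Fin d)] (hH : H.Connected)
    (hF : F.Connected) (hprime : H.RelativelyPrime F) (hc : F.IsDistinguishing c)
    (hcard : 2 ≤ Fintype.card V) (heven : Even (Fintype.card V * Fintype.card W))
    (hwin : Even (Fintype.card V) → Wins H Player.rascal fun _ => (none : Option (Fin d)))
    (hopen : Odd (Fintype.card V) →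
      ∀ x (a : Fin d), Wins H Player.rascal (Function.update (fun _ => none) x (some a))) :
    Wins (H □ F) Player.rascal fun _ => (none : Option (Fin d)) := by
  obtain ⟨a₀, -⟩ := exists_pair_ne (Fin d)
  have hinv : Invariant H c a₀ (fun _ : V × W => (none : Option (Fin d))) :=
    Invariant.initial hcard hwin
  refine hinv.wins hH hF hprime hc hcard hopen ?_
  rwa [uncolored_none, Fintype.card_prod]

/-- If both orders are odd, Gentle starts by opening an arbitrary layer. -/
theorem wins_boxProd_gentle [Fintype W] [DecidableEq W] [Nontrivial (Fin d)] (hH : H.Connected)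
    (hF : F.Connected) (hprime : H.RelativelyPrime F) (hc : F.IsDistinguishing c)
    (hcard : 2 ≤ Fintype.card V) (hV : Odd (Fintype.card V)) (hW : Odd (Fintype.card W))
    (hopen : ∀ x (a : Fin d), Wins H Player.rascal (Function.update (fun _ => none) x (some a))) :
    Wins (H □ F) Player.gentle fun _ => (none : Option (Fin d)) := by
  obtain ⟨a₀, -⟩ := exists_pair_ne (Fin d)
  obtain ⟨x⟩ := hH.nonempty
  obtain ⟨v⟩ := hF.nonempty
  have hempty : Invariant H c a₀ (fun _ : V × W => (none : Option (Fin d))) :=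
    Invariant.initial hcard fun h => absurd h (Nat.not_even_iff_odd.2 hV)
  have hinv : Invariant H c a₀ (Function.update (fun _ => none) (x, v) (some a₀)) :=
    hempty.of_openings (v := v) (w := v) hcard hV hopen rfl rfl (layer_update_self _ x v _)
      (layer_update_self _ x v _) fun u hu _ => layer_update_of_ne _ _ hu _
  refine Wins.gentle _ (x, v) a₀ rfl (hinv.wins hH hF hprime hc hcard (fun _ => hopen) ?_)
  have h := uncolored_update_none (x, v) a₀
  rw [Fintype.card_prod] at h
  obtain ⟨k, hk⟩ := hV.mul hW
  exact ⟨k, by omega⟩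

end Layers

end DistinguishingGame

/-! ### Distinguishing numbers -/

theorem IsDistinguishing.comp_injective {V C C' : Type*} {G : SimpleGraph V} {c : V → C}
    (hc : G.IsDistinguishing c) {f : C → C'} (hf : Function.Injective f) :
    G.IsDistinguishing fun x => f (c x) :=
  fun σ hσ => hc σ fun x => hf (hσ x)

theorem IsDistinguishing.distinguishingNumber_le {V : Type*} {d : ℕ} {G : SimpleGraph V}
    {c : V → Fin d} (hc : G.IsDistinguishing c) : G.distinguishingNumber ≤ d :=
  iInf₂_le d ⟨c, hc⟩

theorem exists_isDistinguishing_of_distinguishingNumber_le {V : Type*} {d : ℕ} {G : SimpleGraph V}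
    (h : G.distinguishingNumber ≤ d) : ∃ c : V → Fin d, G.IsDistinguishing c := by
  have hlt : G.distinguishingNumber < (d + 1 : ℕ) :=
    lt_of_le_of_lt h (by exact_mod_cast Nat.lt_succ_self d)
  obtain ⟨e, he⟩ := iInf_lt_iff.1 hlt
  obtain ⟨⟨c, hc⟩, he⟩ := iInf_lt_iff.1 he
  have hed : e ≤ d := Nat.lt_succ_iff.1 (by exact_mod_cast he)
  exact ⟨_, hc.comp_injective (Fin.castLE_injective hed)⟩

/-- Gentle can only win with at least `D(G)` colors. -/
theorem DistinguishingGame.Wins.nontrivial_fin {V : Type*} [DecidableEq V] {G : SimpleGraph V}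
    {d : ℕ} {t : Player} {P : V → Option (Fin d)} (h : Wins G t P) (hd : 0 < d)
    (hG : 2 ≤ G.distinguishingNumber) : Nontrivial (Fin d) := by
  obtain ⟨c, hc⟩ := h.exists_isDistinguishing hd
  have : 2 ≤ d := by exact_mod_cast hG.trans hc.distinguishingNumber_le
  exact Fin.nontrivial_iff_two_le.2 this

/-- A graph with a single vertex has distinguishing number at most `1`. -/
theorem two_le_card_of_two_le_distinguishingNumber {V : Type*} [Fintype V] {G : SimpleGraph V}
    (h : 2 ≤ G.distinguishingNumber) : 2 ≤ Fintype.card V := by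
  by_contra! hlt
  have hsub := Fintype.card_le_one_iff.1 (Nat.lt_succ_iff.1 hlt)
  have hc : G.IsDistinguishing fun _ => (0 : Fin 1) := fun σ _ x => hsub _ _
  have := h.trans hc.distinguishingNumber_le
  exact absurd this (by decide)

end SimpleGraph

theorem proposition5p6 {V W : Type*} [Fintype V] [Fintype W]
    (H : SimpleGraph V) (F : SimpleGraph W)
    (hH : H.Connected) (hF : F.Connected)
    (hprime : H.RelativelyPrime F)
    (htrans : H.IsVertexTransitive)
    (hDH : 2 ≤ H.distinguishingNumber)
    (hDF : F.distinguishingNumber ≤ 2) :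
    (Odd (Fintype.card V) → Odd (Fintype.card W) →
        (H □ F).gGameNumber ≤ H.gGameNumber) ∧
    (Odd (Fintype.card V) → Even (Fintype.card W) →
        (H □ F).rGameNumber ≤ H.gGameNumber) ∧
    (Even (Fintype.card V) →
        (H □ F).rGameNumber ≤ H.rGameNumber) := by
  classical
  have := hH.nonempty
  have := hF.nonempty
  have hcard := SimpleGraph.two_le_card_of_two_le_distinguishingNumber hDH
  obtain ⟨c, hc⟩ : ∃ c : W → ZMod 2, F.IsDistinguishing c :=
    SimpleGraph.exists_isDistinguishing_of_distinguishingNumber_le (d := 2) hDF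
  refine ⟨fun hV hW => SimpleGraph.DistinguishingGame.gameNumber_le_gameNumber fun d hd hw => ?_,
    fun hV hW => SimpleGraph.DistinguishingGame.gameNumber_le_gameNumber fun d hd hw => ?_,
    fun hV => SimpleGraph.DistinguishingGame.gameNumber_le_gameNumber fun d hd hw => ?_⟩
  all_goals have := hw.nontrivial_fin hd hDH
  · exact SimpleGraph.DistinguishingGame.wins_boxProd_gentle hH hF hprime hc hcard hV hW
      (hw.opening htrans)
  · exact SimpleGraph.DistinguishingGame.wins_boxProd_rascal hH hF hprime hc hcard (hW.mul_left _)
      (fun h => absurd h (Nat.not_even_iff_odd.2 hV)) fun _ => hw.opening htrans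
  · exact SimpleGraph.DistinguishingGame.wins_boxProd_rascal hH hF hprime hc hcard (hV.mul_right _)
      (fun _ => hw) fun h => absurd hV (Nat.not_even_iff_odd.2 h)
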